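/- Let $(X,\mathcal B,\mu,T)$ be a non-atomic ergodic measure-preserving system; that is, $X$ is a compact metric space, $\mathcal B$ is its Borel $\sigma$-algebra, $\mu$ is a Borel probability measure on $X$ with no atoms, and $T:X\to X$ is a $\mu$-preserving ergodic transformation (not assumed to be invertible). For $n\in\mathbb N=\{1,2,3,\dots\}$ let $\Omega(n)$ denote the number of prime factors of $n$ counted with multiplicity. Then for every $\varepsilon>0$ there is a set $A\in\mathcal B$ with $\mu(A)<\varepsilon$ such that, for $\mu$-almost every $x\in X$, $$\limsup_{N\to\infty}\frac1{\log N}\sum_{n=1}^{N}\frac{\mathbf 1_A\bigl(T^{\Omega(n)}x\bigr)}{n}=1\qquad\text{and}\qquad\liminf_{N\to\infty}\frac1{\log N}\sum_{n=1}^{N}\frac{\mathbf 1_A\bigl(T^{\Omega(n)}x\bigr)}{n}=0 .$$ -/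

import Mathlib

open Filter MeasureTheory
open scoped ArithmeticFunction.Omega

/-- The logarithmic average `(1 / log N) * ∑_{n = 1}^N a n / n` of a real sequence `a`.
For `N ≤ 1` the value is `0` by convention, which does not affect limits in `N`. -/
noncomputable def logAverage (a : ℕ → ℝ) (N : ℕ) : ℝ :=
  (1 / Real.log N) * ∑ n ∈ Finset.Icc 1 N, a n / n

/-! With weights `1 / n` on `n ≤ N`, the function `Ω` has mean `primeRecipSum N + O(1)` and, at
scales where `primeRecipSum N` is near `M`, mean square deviation `O(M)` from `M` (Turán–Kubilius).
By Chebyshev, if the orbit of `x` lies in `A` at all times in `[M - K, M + K]` with `K ^ 2 ≥ m * M`,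
the logarithmic average at such an `N` is at least `1 - O(1 / m)`; if the orbit avoids `A` there,
the average is `O(1 / m)`. It remains to find a small `A` whose typical orbits have both kinds of
run for arbitrarily large `m` (`HasRun`).

One long run is produced by `exists_hasRun_set`: a Rokhlin-type tower, built from first hitting
times of a tiny set so that invertibility is not needed, gives a set `S` of small measure in which
most orbits make a run before a bounded time `H`. In `exists_set_frequently_hasRun` such sets `S j`
are chosen successively, each so small that most orbits miss all later ones up to time `H j`.
Letting even indices put points into `A` and odd indices remove them, Borel–Cantelli gives both
kinds of run almost everywhere. -/

/-- The harmonic sum `∑_{n = 1}^N 1 / n` as a real number. -/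
noncomputable def harmonicSum (N : ℕ) : ℝ := ∑ n ∈ Finset.Icc 1 N, (1 : ℝ) / n

/-- The sum of `1 / p` over the primes `p ≤ N`. -/
noncomputable def primeRecipSum (N : ℕ) : ℝ := ∑ p ∈ Nat.primesLE N, (1 : ℝ) / p

lemma harmonicSum_eq (N : ℕ) : harmonicSum N = harmonic N := by
  rw [harmonicSum, harmonic_eq_sum_Icc]
  push_cast
  simp

lemma harmonicSum_le_one_add_log (N : ℕ) : harmonicSum N ≤ 1 + Real.log N := by
  rw [harmonicSum_eq]; exact harmonic_le_one_add_log N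

lemma log_add_one_le_harmonicSum (N : ℕ) : Real.log (N + 1) ≤ harmonicSum N := by
  rw [harmonicSum_eq]; exact_mod_cast log_add_one_le_harmonic N

lemma log_le_harmonicSum (N : ℕ) : Real.log N ≤ harmonicSum N := by
  rcases Nat.eq_zero_or_pos N with rfl | h
  · simp [harmonicSum]
  · refine le_trans (Real.log_le_log (by exact_mod_cast h) (by linarith)) (log_add_one_le_harmonicSum N)

lemma harmonicSum_mono : Monotone harmonicSum := fun a b h => by
  refine Finset.sum_le_sum_of_subset_of_nonneg (Finset.Icc_subset_Icc_right h) ?_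
  intros; positivity

lemma one_le_harmonicSum {N : ℕ} (h : 1 ≤ N) : 1 ≤ harmonicSum N :=
  le_trans (by simp [harmonicSum]) (harmonicSum_mono h)

lemma primeRecipSum_le_harmonicSum (N : ℕ) : primeRecipSum N ≤ harmonicSum N := by
  refine Finset.sum_le_sum_of_subset_of_nonneg ?_ ?_
  · intro p hp
    rw [Nat.mem_primesLE] at hp
    exact Finset.mem_Icc.2 ⟨hp.2.one_le, hp.1⟩
  · intros; positivity

/-! ### Upper bounds for the logarithmic moments of `Ω` -/

lemma sum_Icc_dvd (f : ℕ → ℝ) {d : ℕ} (hd : 0 < d) (N : ℕ) :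
    ∑ n ∈ Finset.Icc 1 N, (if d ∣ n then f n else 0) =
      ∑ m ∈ Finset.Icc 1 (N / d), f (d * m) := by
  rw [← Finset.sum_filter]
  symm
  refine Finset.sum_bij (fun m _ => d * m) ?_ ?_ ?_ ?_
  · intro m hm
    rw [Finset.mem_Icc] at hm
    rw [Finset.mem_filter, Finset.mem_Icc]
    refine ⟨⟨Nat.mul_pos hd hm.1, ?_⟩, dvd_mul_right _ _⟩
    have := (Nat.le_div_iff_mul_le hd).1 hm.2
    linarith
  · intro a _ b _ h
    exact Nat.eq_of_mul_eq_mul_left hd h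
  · intro n hn
    rw [Finset.mem_filter, Finset.mem_Icc] at hn
    obtain ⟨⟨h1, h2⟩, m, rfl⟩ := hn
    refine ⟨m, ?_, rfl⟩
    rw [Finset.mem_Icc, Nat.le_div_iff_mul_le hd]
    refine ⟨Nat.pos_of_ne_zero ?_, by linarith⟩
    rintro rfl; simp at h1
  · intros; rfl

lemma factorization_eq_sum_Icc {n N p : ℕ} (hp : p.Prime) (hn : 1 ≤ n) (hN : n ≤ N) :
    (n.factorization p : ℝ) = ∑ k ∈ Finset.Icc 1 N, if p ^ k ∣ n then (1 : ℝ) else 0 := by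
  rw [Finset.sum_boole]
  congr 1
  have h : (Finset.Icc 1 N).filter (fun k => p ^ k ∣ n) = Finset.Icc 1 (n.factorization p) := by
    ext k
    rw [Finset.mem_filter, Finset.mem_Icc, Finset.mem_Icc,
      hp.pow_dvd_iff_le_factorization (by omega)]
    have : n.factorization p < n := Nat.factorization_lt p (by omega)
    omega
  rw [h]; simp

lemma cardFactors_eq_sum {n N : ℕ} (hn : 1 ≤ n) (hN : n ≤ N) :
    (Ω n : ℝ) = ∑ p ∈ Nat.primesLE N, ∑ k ∈ Finset.Icc 1 N,
      if p ^ k ∣ n then (1 : ℝ) else 0 := by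
  rw [ArithmeticFunction.cardFactors_eq_sum_factorization, Finsupp.sum]
  push_cast
  rw [Finset.sum_subset (s₂ := Nat.primesLE N)]
  · exact Finset.sum_congr rfl fun p hp =>
      factorization_eq_sum_Icc ((Nat.mem_primesLE).1 hp).2 hn hN
  · intro p hp
    rw [Nat.support_factorization, Nat.mem_primeFactors] at hp
    exact Nat.mem_primesLE.2 ⟨(Nat.le_of_dvd hn hp.2.1).trans hN, hp.1⟩
  · intro p _ hp
    exact_mod_cast Finsupp.notMem_support_iff.1 hp

/-- Summation of `Ω * g` against the logarithmic weight, unfolded over prime powers. -/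
lemma sum_cardFactors_mul (g : ℕ → ℝ) (N : ℕ) :
    ∑ n ∈ Finset.Icc 1 N, (Ω n : ℝ) * g n / n =
      ∑ p ∈ Nat.primesLE N, ∑ k ∈ Finset.Icc 1 N, (1 / (p : ℝ) ^ k) *
        ∑ m ∈ Finset.Icc 1 (N / p ^ k), g (p ^ k * m) / m := by
  have h1 : ∀ n ∈ Finset.Icc 1 N, (Ω n : ℝ) * g n / n =
      ∑ p ∈ Nat.primesLE N, ∑ k ∈ Finset.Icc 1 N, if p ^ k ∣ n then g n / n else 0 := by
    intro n hn
    rw [Finset.mem_Icc] at hn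
    rw [cardFactors_eq_sum hn.1 hn.2, mul_div_assoc, Finset.sum_mul]
    refine Finset.sum_congr rfl fun p _ => ?_
    rw [Finset.sum_mul]
    exact Finset.sum_congr rfl fun k _ => by split_ifs <;> simp
  rw [Finset.sum_congr rfl h1, Finset.sum_comm]
  refine Finset.sum_congr rfl fun p hp => ?_
  have hp' := (Nat.mem_primesLE.1 hp).2
  rw [Finset.sum_comm]
  refine Finset.sum_congr rfl fun k _ => ?_
  rw [sum_Icc_dvd (fun n => g n / n) (pow_pos hp'.pos k), Finset.mul_sum]
  refine Finset.sum_congr rfl fun m hm => ?_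
  push_cast
  rw [one_div, inv_mul_eq_div, div_div, mul_comm (m : ℝ)]

/-- The weighted sum `∑ k / p ^ k` over primes `p ≤ N` and exponents `1 ≤ k ≤ N`. -/
noncomputable def primePowSum (N : ℕ) : ℝ :=
  ∑ p ∈ Nat.primesLE N, ∑ k ∈ Finset.Icc 1 N, (k : ℝ) * (1 / (p : ℝ) ^ k)

lemma sum_geometric_le {p : ℕ} (hp : 2 ≤ p) (N : ℕ) :
    ∑ k ∈ Finset.Icc 1 N, (k : ℝ) * (1 / (p : ℝ) ^ k) ≤ 1 / p + 8 * (1 / (p : ℝ) ^ 2) := by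
  have hp' : (2 : ℝ) ≤ p := by exact_mod_cast hp
  have hr : ‖(1 / (p : ℝ))‖ < 1 := by
    rw [Real.norm_of_nonneg (by positivity), div_lt_one (by linarith)]; linarith
  have h := hasSum_coe_mul_geometric_of_norm_lt_one hr
  have h2 := sum_le_hasSum (Finset.Icc 1 N) (fun i _ => by positivity) h
  simp only [one_div, inv_pow] at h2 ⊢
  refine h2.trans ?_
  have h3 : (p : ℝ)⁻¹ / (1 - (p : ℝ)⁻¹) ^ 2 = p / (p - 1) ^ 2 := by
    have : (p : ℝ) - 1 ≠ 0 := by linarith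
    field_simp
  have h4 : (p : ℝ)⁻¹ + 8 * ((p : ℝ) ^ 2)⁻¹ = (p + 8) / p ^ 2 := by
    field_simp
  -- After clearing denominators this is `6 * p ^ 2 - 15 * p + 8 ≥ 0`, true for `p ≥ 2`.
  rw [h3, h4, div_le_div_iff₀ (by nlinarith) (by positivity)]
  nlinarith

/-- Exponents `k ≥ 2` contribute only `O(1 / p ^ 2)` for each prime, which is summable. -/
lemma exists_primePowSum_le : ∃ C : ℝ, 0 ≤ C ∧ ∀ N, primePowSum N ≤ primeRecipSum N + C := by
  have hs : Summable (fun n : ℕ => 8 * (1 / (n : ℝ) ^ 2)) :=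
    (Real.summable_one_div_nat_pow.2 one_lt_two).mul_left 8
  refine ⟨∑' n : ℕ, 8 * (1 / (n : ℝ) ^ 2), tsum_nonneg fun _ => by positivity, fun N => ?_⟩
  calc primePowSum N ≤ ∑ p ∈ Nat.primesLE N, (1 / (p : ℝ) + 8 * (1 / (p : ℝ) ^ 2)) :=
        Finset.sum_le_sum fun p hp => sum_geometric_le (Nat.mem_primesLE.1 hp).2.two_le N
    _ = primeRecipSum N + ∑ p ∈ Nat.primesLE N, 8 * (1 / (p : ℝ) ^ 2) :=
        Finset.sum_add_distrib
    _ ≤ _ := by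
        gcongr
        exact hs.sum_le_tsum _ fun _ _ => by positivity

lemma primePowSum_nonneg (N : ℕ) : 0 ≤ primePowSum N :=
  Finset.sum_nonneg fun _ _ => Finset.sum_nonneg fun _ _ => by positivity

lemma sum_div_le_of_le {g : ℕ → ℝ} (hg : ∀ n, 0 ≤ g n) {a b : ℕ} (h : a ≤ b) :
    ∑ m ∈ Finset.Icc 1 a, g m / m ≤ ∑ m ∈ Finset.Icc 1 b, g m / m :=
  Finset.sum_le_sum_of_subset_of_nonneg (Finset.Icc_subset_Icc_right h)
    fun i _ _ => div_nonneg (hg i) (by positivity)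

lemma sum_cardFactors_le (N : ℕ) :
    ∑ n ∈ Finset.Icc 1 N, (Ω n : ℝ) / n ≤ primePowSum N * harmonicSum N := by
  have h := sum_cardFactors_mul (fun _ => 1) N
  simp only [mul_one] at h
  rw [h, primePowSum, Finset.sum_mul]
  refine Finset.sum_le_sum fun p _ => ?_
  rw [Finset.sum_mul]
  refine Finset.sum_le_sum fun k hk => ?_
  have hk' : (1 : ℝ) ≤ k := by exact_mod_cast (Finset.mem_Icc.1 hk).1
  refine mul_le_mul ?_ (harmonicSum_mono (Nat.div_le_self _ _)) ?_ (by positivity)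
  · exact le_mul_of_one_le_left (by positivity) hk'
  · exact Finset.sum_nonneg fun _ _ => by positivity

/-- Only one factor `Ω` is expanded over prime powers; the other splits as `Ω (p ^ k * m) = k + Ω
m`. This bounds the second moment by `primePowSum N` times harmonic sum plus first moment. -/
lemma sum_cardFactors_sq_le (N : ℕ) :
    ∑ n ∈ Finset.Icc 1 N, (Ω n : ℝ) ^ 2 / n ≤
      (primePowSum N + primePowSum N ^ 2) * harmonicSum N := by
  have h := sum_cardFactors_mul (fun n => (Ω n : ℝ)) N
  simp only [← pow_two] at h
  set S := ∑ n ∈ Finset.Icc 1 N, (Ω n : ℝ) / n with hS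
  have hS0 : 0 ≤ S := Finset.sum_nonneg fun _ _ => by positivity
  have hH0 : 0 ≤ harmonicSum N := Finset.sum_nonneg fun _ _ => by positivity
  have key : ∑ n ∈ Finset.Icc 1 N, (Ω n : ℝ) ^ 2 / n ≤
      primePowSum N * (harmonicSum N + S) := by
    rw [h, primePowSum, Finset.sum_mul]
    refine Finset.sum_le_sum fun p hp => ?_
    have hp' := (Nat.mem_primesLE.1 hp).2
    rw [Finset.sum_mul]
    refine Finset.sum_le_sum fun k hk => ?_
    have hk' : (1 : ℝ) ≤ k := by exact_mod_cast (Finset.mem_Icc.1 hk).1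
    have h1 : ∑ m ∈ Finset.Icc 1 (N / p ^ k), (Ω (p ^ k * m) : ℝ) / m =
        k * harmonicSum (N / p ^ k) + ∑ m ∈ Finset.Icc 1 (N / p ^ k), (Ω m : ℝ) / m := by
      rw [harmonicSum, Finset.mul_sum, ← Finset.sum_add_distrib]
      refine Finset.sum_congr rfl fun m hm => ?_
      rw [ArithmeticFunction.cardFactors_mul (pow_ne_zero _ hp'.ne_zero)
        (by have := (Finset.mem_Icc.1 hm).1; omega),
        ArithmeticFunction.cardFactors_apply_prime_pow hp']
      push_cast; ring
    have h2 : harmonicSum (N / p ^ k) ≤ harmonicSum N := harmonicSum_mono (Nat.div_le_self _ _)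
    have h3 : ∑ m ∈ Finset.Icc 1 (N / p ^ k), (Ω m : ℝ) / m ≤ S :=
      sum_div_le_of_le (fun _ => by positivity) (Nat.div_le_self _ _)
    rw [h1]
    calc 1 / (p : ℝ) ^ k * (k * harmonicSum (N / p ^ k) +
          ∑ m ∈ Finset.Icc 1 (N / p ^ k), (Ω m : ℝ) / m)
        ≤ 1 / (p : ℝ) ^ k * (k * harmonicSum N + k * S) := by
          gcongr
          exact h3.trans (le_mul_of_one_le_left hS0 hk')
      _ = _ := by ring
  have := mul_le_mul_of_nonneg_left (sum_cardFactors_le N) (primePowSum_nonneg N)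
  rw [← hS] at this
  linarith

/-! ### Mertens-type bound and the lower bound for the first moment -/

lemma sum_log_prime_le_log {n x : ℕ} (hn : 1 ≤ n) :
    ∑ p ∈ Nat.primesLE x, (if p ∣ n then Real.log p else 0) ≤ Real.log n := by
  rw [← ArithmeticFunction.vonMangoldt_sum, ← Finset.sum_filter]
  calc ∑ p ∈ (Nat.primesLE x).filter (· ∣ n), Real.log p
      = ∑ p ∈ (Nat.primesLE x).filter (· ∣ n), ArithmeticFunction.vonMangoldt p := by
        refine Finset.sum_congr rfl fun p hp => ?_
        rw [ArithmeticFunction.vonMangoldt_apply_prime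
          (Nat.mem_primesLE.1 (Finset.mem_filter.1 hp).1).2]
    _ ≤ _ := by
        refine Finset.sum_le_sum_of_subset_of_nonneg ?_ ?_
        · intro p hp
          exact Nat.mem_divisors.2 ⟨(Finset.mem_filter.1 hp).2, by omega⟩
        · intros; exact ArithmeticFunction.vonMangoldt_nonneg

/-- A weak form of Mertens' first theorem. -/
lemma sum_log_div_prime_le {x : ℕ} (hx : 1 ≤ x) :
    ∑ p ∈ Nat.primesLE x, Real.log p / p ≤ 6 * harmonicSum x := by
  set G := ∑ p ∈ Nat.primesLE x, Real.log p / p with hG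
  have hH := one_le_harmonicSum hx
  have hl := log_le_harmonicSum x
  have hl0 : 0 ≤ Real.log x := Real.log_natCast_nonneg x
  -- Summing up to `x ^ 2` leaves, for every `p ≤ x`, at least `x` multiples of `p`, so each inner
  -- harmonic sum is at least `harmonicSum x`.
  have h1 : G * harmonicSum x ≤ ∑ n ∈ Finset.Icc 1 (x ^ 2), Real.log n / n := by
    calc G * harmonicSum x
        ≤ ∑ p ∈ Nat.primesLE x, Real.log p / p * harmonicSum (x ^ 2 / p) := by
          rw [hG, Finset.sum_mul]
          refine Finset.sum_le_sum fun p hp => ?_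
          obtain ⟨h1, h2⟩ := Nat.mem_primesLE.1 hp
          refine mul_le_mul_of_nonneg_left (harmonicSum_mono ?_)
            (div_nonneg (Real.log_natCast_nonneg p) (by positivity))
          rw [Nat.le_div_iff_mul_le h2.pos, pow_two]
          exact Nat.mul_le_mul_left _ h1
      _ = ∑ p ∈ Nat.primesLE x, ∑ n ∈ Finset.Icc 1 (x ^ 2),
            (if p ∣ n then Real.log p / n else 0) := by
          refine Finset.sum_congr rfl fun p hp => ?_
          rw [sum_Icc_dvd (fun n => Real.log p / n) (Nat.mem_primesLE.1 hp).2.pos,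
            harmonicSum, Finset.mul_sum]
          refine Finset.sum_congr rfl fun m _ => ?_
          push_cast
          rw [div_mul_div_comm, mul_one]
      _ = ∑ n ∈ Finset.Icc 1 (x ^ 2),
            (∑ p ∈ Nat.primesLE x, if p ∣ n then Real.log p else 0) / n := by
          rw [Finset.sum_comm]
          refine Finset.sum_congr rfl fun n _ => ?_
          rw [Finset.sum_div]
          exact Finset.sum_congr rfl fun p _ => by split_ifs <;> simp
      _ ≤ _ := by
          refine Finset.sum_le_sum fun n hn => ?_
          exact div_le_div_of_nonneg_right (sum_log_prime_le_log (Finset.mem_Icc.1 hn).1)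
            (by positivity)
  have h2 : ∑ n ∈ Finset.Icc 1 (x ^ 2), Real.log n / n ≤
      2 * Real.log x * (1 + 2 * Real.log x) := by
    have hlog : Real.log ((x ^ 2 : ℕ) : ℝ) = 2 * Real.log x := by
      push_cast; rw [Real.log_pow]; norm_num
    calc ∑ n ∈ Finset.Icc 1 (x ^ 2), Real.log n / n
        ≤ ∑ n ∈ Finset.Icc 1 (x ^ 2), Real.log ((x ^ 2 : ℕ) : ℝ) * (1 / n) := by
          refine Finset.sum_le_sum fun n hn => ?_
          obtain ⟨ha, hb⟩ := Finset.mem_Icc.1 hn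
          rw [div_eq_mul_one_div]
          have : Real.log n ≤ Real.log ((x ^ 2 : ℕ) : ℝ) :=
            Real.log_le_log (by exact_mod_cast ha) (by exact_mod_cast hb)
          gcongr
      _ = Real.log ((x ^ 2 : ℕ) : ℝ) * harmonicSum (x ^ 2) := by
          rw [harmonicSum, Finset.mul_sum]
      _ ≤ _ := by
          have := harmonicSum_le_one_add_log (x ^ 2)
          rw [hlog] at this ⊢
          gcongr
  -- Since `log x ≤ harmonicSum x` and `1 ≤ harmonicSum x`, the two terms `2 log x` and `4 (log x) ^
  -- 2` give the constant `6`.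
  have h3 : G * harmonicSum x ≤ (6 * harmonicSum x) * harmonicSum x := by nlinarith
  exact le_of_mul_le_mul_right h3 (by linarith)

lemma harmonicSum_sub_le {N p : ℕ} (hN : 1 ≤ N) (hp : 0 < p) :
    harmonicSum N - 1 - Real.log p ≤ harmonicSum (N / p) := by
  have h1 := harmonicSum_le_one_add_log N
  have h2 := log_add_one_le_harmonicSum (N / p)
  have hN' : (0 : ℝ) < N := by exact_mod_cast hN
  have hp' : (0 : ℝ) < p := by exact_mod_cast hp
  have h3 : Real.log ((N : ℝ) / p) ≤ Real.log ((N / p : ℕ) + 1) := by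
    refine Real.log_le_log (by positivity) ?_
    rw [div_le_iff₀ hp']
    have := (Nat.lt_mul_div_succ N hp).le
    rw [mul_comm] at this
    exact_mod_cast this
  rw [Real.log_div hN'.ne' hp'.ne'] at h3
  linarith

/-- Only the exponent `k = 1` is kept. Replacing `N / p` by `N` costs `1 + log p` per prime, in
total at most `1 + 6 = 7` harmonic sums. -/
lemma le_sum_cardFactors {N : ℕ} (hN : 1 ≤ N) :
    (primeRecipSum N - 7) * harmonicSum N ≤ ∑ n ∈ Finset.Icc 1 N, (Ω n : ℝ) / n := by
  have h := sum_cardFactors_mul (fun _ => 1) N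
  simp only [mul_one] at h
  have h1 : ∑ p ∈ Nat.primesLE N, (1 / (p : ℝ)) * harmonicSum (N / p) ≤
      ∑ n ∈ Finset.Icc 1 N, (Ω n : ℝ) / n := by
    rw [h]
    refine Finset.sum_le_sum fun p _ => ?_
    refine le_trans (le_of_eq ?_) (Finset.single_le_sum
      (f := fun k => 1 / (p : ℝ) ^ k * ∑ m ∈ Finset.Icc 1 (N / p ^ k), 1 / (m : ℝ))
      (fun k _ => ?_) (Finset.left_mem_Icc.2 hN))
    · simp only [pow_one, harmonicSum]
    · exact mul_nonneg (by positivity) (Finset.sum_nonneg fun _ _ => by positivity)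
  have h2 : ∑ p ∈ Nat.primesLE N, (1 / (p : ℝ)) * (harmonicSum N - 1 - Real.log p) ≤
      ∑ p ∈ Nat.primesLE N, (1 / (p : ℝ)) * harmonicSum (N / p) := by
    refine Finset.sum_le_sum fun p hp => ?_
    have := harmonicSum_sub_le hN (Nat.mem_primesLE.1 hp).2.pos
    gcongr
  have h3 : ∑ p ∈ Nat.primesLE N, (1 / (p : ℝ)) * (harmonicSum N - 1 - Real.log p) =
      primeRecipSum N * (harmonicSum N - 1) - ∑ p ∈ Nat.primesLE N, Real.log p / p := by
    rw [primeRecipSum, Finset.sum_mul, ← Finset.sum_sub_distrib]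
    exact Finset.sum_congr rfl fun p _ => by ring
  have h4 := sum_log_div_prime_le hN
  have h5 := primeRecipSum_le_harmonicSum N
  linarith

/-! ### Choice of scale and concentration of `Ω` -/

lemma primeRecipSum_succ_le (N : ℕ) : primeRecipSum (N + 1) ≤ primeRecipSum N + 1 := by
  have h : primeRecipSum (N + 1) ≤
      ∑ p ∈ insert (N + 1) (Nat.primesLE N), (1 : ℝ) / p := by
    refine Finset.sum_le_sum_of_subset_of_nonneg ?_ fun _ _ _ => by positivity
    intro p hp
    rw [Nat.mem_primesLE] at hp
    rw [Finset.mem_insert, Nat.mem_primesLE]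
    rcases Nat.lt_or_ge N p with h | h
    · left; omega
    · right; exact ⟨h, hp.2⟩
  rw [Finset.sum_insert (by simp [Nat.mem_primesLE])] at h
  have : (1 : ℝ) / ((N + 1 : ℕ) : ℝ) ≤ 1 := by
    rw [div_le_one (by positivity)]; push_cast; linarith [Nat.cast_nonneg (α := ℝ) N]
  unfold primeRecipSum at h ⊢
  linarith

lemma exists_le_primeRecipSum (M : ℝ) : ∃ N, M ≤ primeRecipSum N := by
  by_contra! hcon
  refine not_summable_one_div_on_primes (summable_of_sum_range_le (c := M) ?_ ?_)
  · intro n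
    exact Set.indicator_nonneg (fun _ _ => by positivity) n
  · intro n
    refine le_trans (le_of_eq ?_) (hcon (n - 1)).le
    rw [primeRecipSum, ← Finset.sum_filter_add_sum_filter_not (Finset.range n) Nat.Prime]
    rw [Finset.sum_eq_zero (s := (Finset.range n).filter (fun i => ¬ i.Prime)), add_zero]
    · rcases n with _ | n
      · simp [Nat.primesLE, Nat.primesBelow, Finset.filter_singleton, Nat.not_prime_zero]
      · refine Finset.sum_congr rfl fun p hp => ?_
        exact Set.indicator_of_mem (s := {p : ℕ | p.Prime}) (Finset.mem_filter.1 hp).2 _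
    · intro p hp
      exact Set.indicator_of_notMem (s := {p : ℕ | p.Prime}) (Finset.mem_filter.1 hp).2 _

/-- The sum is unbounded and grows by at most `1` per step, so the first `N` reaching `M` overshoots
by at most `1`. -/
lemma exists_primeRecipSum_near {M : ℕ} (hM : 1 ≤ M) :
    ∃ N, M ≤ N ∧ (M : ℝ) ≤ primeRecipSum N ∧ primeRecipSum N ≤ M + 1 := by
  classical
  have hex := exists_le_primeRecipSum M
  refine ⟨Nat.find hex, ?_, Nat.find_spec hex, ?_⟩
  · have h := Nat.find_spec hex
    have h2 : primeRecipSum (Nat.find hex) ≤ (Nat.find hex : ℕ) := by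
      refine (Finset.sum_le_card_nsmul _ _ 1 fun p hp => ?_).trans ?_
      · have : (1 : ℝ) ≤ p := by exact_mod_cast (Nat.mem_primesLE.1 hp).2.one_le
        rw [div_le_one (by linarith)]; exact this
      · rw [nsmul_one]
        have : Nat.primesLE (Nat.find hex) ⊆ Finset.Icc 1 (Nat.find hex) := fun p hp =>
          Finset.mem_Icc.2 ⟨(Nat.mem_primesLE.1 hp).2.one_le, (Nat.mem_primesLE.1 hp).1⟩
        have := Finset.card_le_card this
        rw [Nat.card_Icc] at this
        exact_mod_cast this
    exact_mod_cast h.trans h2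
  · rcases hN : Nat.find hex with _ | n
    · simp only [primeRecipSum]
      simp [Nat.primesLE, Nat.primesBelow, Finset.filter_singleton, Nat.not_prime_zero]
      positivity
    · have h1 := Nat.find_min hex (m := n) (by omega)
      have h2 := primeRecipSum_succ_le n
      linarith [not_le.1 h1]

/-- A Turán–Kubilius inequality for `Ω` with logarithmic weights. -/
lemma exists_sum_cardFactors_sub_sq_le : ∃ C : ℝ, 0 < C ∧ ∀ M : ℕ, 1 ≤ M → ∃ N, M ≤ N ∧
    ∑ n ∈ Finset.Icc 1 N, ((Ω n : ℝ) - M) ^ 2 / n ≤ C * M * harmonicSum N := by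
  obtain ⟨C, hC0, hC⟩ := exists_primePowSum_le
  refine ⟨(C + 1) + 1 + 2 * (C + 1) + (C + 1) ^ 2 + 14, by positivity, fun M hM => ?_⟩
  obtain ⟨N, hMN, h1, h2⟩ := exists_primeRecipSum_near hM
  refine ⟨N, hMN, ?_⟩
  have hM' : (1 : ℝ) ≤ M := by exact_mod_cast hM
  have hN : 1 ≤ N := hM.trans hMN
  have hH := one_le_harmonicSum hN
  have e : ∑ n ∈ Finset.Icc 1 N, ((Ω n : ℝ) - M) ^ 2 / n =
      ∑ n ∈ Finset.Icc 1 N, (Ω n : ℝ) ^ 2 / n - 2 * M * ∑ n ∈ Finset.Icc 1 N, (Ω n : ℝ) / n +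
        M ^ 2 * harmonicSum N := by
    rw [harmonicSum, Finset.mul_sum, Finset.mul_sum, ← Finset.sum_sub_distrib,
      ← Finset.sum_add_distrib]
    exact Finset.sum_congr rfl fun n _ => by ring
  have hR0 := primePowSum_nonneg N
  have hR : primePowSum N ≤ M + (C + 1) := by linarith [hC N]
  have hA := sum_cardFactors_sq_le N
  have hB := le_sum_cardFactors hN
  have hB' : 2 * (M : ℝ) * ((M - 7) * harmonicSum N) ≤
      2 * M * ∑ n ∈ Finset.Icc 1 N, (Ω n : ℝ) / n := by
    refine mul_le_mul_of_nonneg_left (le_trans ?_ hB) (by linarith)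
    gcongr
  have hA' : (primePowSum N + primePowSum N ^ 2) * harmonicSum N ≤
      ((M + (C + 1)) + (M + (C + 1)) ^ 2) * harmonicSum N := by gcongr
  rw [e]
  -- The terms in `M ^ 2` cancel; the rest is linear in `M`, and its constant part is absorbed using
  -- `1 ≤ M`.
  have hfin : ((M : ℝ) + (C + 1)) + (M + (C + 1)) ^ 2 - 2 * M * (M - 7) + M ^ 2 ≤
      ((C + 1) + 1 + 2 * (C + 1) + (C + 1) ^ 2 + 14) * M := by
    have : 0 ≤ (C + 1 + (C + 1) ^ 2) * ((M : ℝ) - 1) :=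
      mul_nonneg (by positivity) (by linarith)
    nlinarith
  have := mul_le_mul_of_nonneg_right hfin (by linarith : 0 ≤ harmonicSum N)
  linarith

/-- For every `M`, at a suitable scale `N`, the values `Ω n` concentrate around `M`. -/
lemma exists_sum_far_le : ∃ C : ℝ, 0 < C ∧ ∀ M : ℕ, 1 ≤ M → ∃ N, M ≤ N ∧
    ∀ K : ℕ, 0 < K → ∑ n ∈ (Finset.Icc 1 N).filter (fun n => (K : ℝ) < |(Ω n : ℝ) - M|),
      (1 : ℝ) / n ≤ C * M / K ^ 2 * harmonicSum N := by
  obtain ⟨C, hC0, hC⟩ := exists_sum_cardFactors_sub_sq_le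
  refine ⟨C, hC0, fun M hM => ?_⟩
  obtain ⟨N, hMN, h⟩ := hC M hM
  refine ⟨N, hMN, fun K hK => ?_⟩
  have hK' : (0 : ℝ) < K := by exact_mod_cast hK
  rw [div_mul_eq_mul_div, le_div_iff₀ (by positivity), Finset.sum_mul]
  refine le_trans ?_ h
  refine le_trans (Finset.sum_le_sum (g := fun n : ℕ => ((Ω n : ℝ) - M) ^ 2 / n) ?_)
    (Finset.sum_le_sum_of_subset_of_nonneg (Finset.filter_subset _ _)
      fun _ _ _ => by positivity)
  intro n hn
  have h1 := (Finset.mem_filter.1 hn).2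
  rw [div_mul_eq_mul_div, one_mul]
  refine div_le_div_of_nonneg_right ?_ (by positivity)
  rw [← sq_abs ((Ω n : ℝ) - M)]
  gcongr

/-! ### From runs to logarithmic averages -/

/-- `P` holds on an interval `[M - K, M + K] ⊆ [0, H]` with `M ≥ m` and `K ≥ √(m M)`. -/
def HasRun (P : ℕ → Prop) (m H : ℕ) : Prop :=
  ∃ M K : ℕ, m ≤ M ∧ 0 < K ∧ m * M ≤ K ^ 2 ∧ M + K ≤ H ∧ ∀ k, M ≤ k + K → k ≤ M + K → P k

lemma HasRun.imp {P Q : ℕ → Prop} {m H : ℕ} (h : HasRun P m H) (hPQ : ∀ k ≤ H, P k → Q k) :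
    HasRun Q m H := by
  obtain ⟨M, K, h1, h2, h3, h4, h5⟩ := h
  exact ⟨M, K, h1, h2, h3, h4, fun k ha hb => hPQ k (hb.trans h4) (h5 k ha hb)⟩

/-- Chebyshev at the scale attached to the centre `M` of the run: `m * M ≤ K ^ 2` turns `C * M / K ^
2` into `C / m`. -/
lemma exists_sum_not_run_le : ∃ C : ℝ, 0 < C ∧ ∀ (P : ℕ → Prop) [DecidablePred P] (m H : ℕ),
    1 ≤ m → HasRun P m H → ∃ N, m ≤ N ∧
      ∑ n ∈ (Finset.Icc 1 N).filter (fun n => ¬ P (Ω n)), (1 : ℝ) / n ≤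
        C / m * harmonicSum N := by
  obtain ⟨C, hC0, hC⟩ := exists_sum_far_le
  refine ⟨C, hC0, fun P _ m H hm ⟨M, K, hmM, hK, hmK, _, hP⟩ => ?_⟩
  obtain ⟨N, hMN, h⟩ := hC M (hm.trans hmM)
  refine ⟨N, hmM.trans hMN, ?_⟩
  have hH : 0 ≤ harmonicSum N := Finset.sum_nonneg fun _ _ => by positivity
  have hm' : (0 : ℝ) < m := by exact_mod_cast hm
  have hK' : (0 : ℝ) < K := by exact_mod_cast hK
  have hmK' : (m : ℝ) * M ≤ K ^ 2 := by exact_mod_cast hmK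
  have h1 : C * M / K ^ 2 ≤ C / m := by
    rw [div_le_div_iff₀ (by positivity) hm']
    nlinarith
  refine le_trans ?_ ((h K hK).trans (mul_le_mul_of_nonneg_right h1 hH))
  refine Finset.sum_le_sum_of_subset_of_nonneg ?_ fun _ _ _ => by positivity
  intro n hn
  rw [Finset.mem_filter] at hn ⊢
  refine ⟨hn.1, ?_⟩
  by_contra hcon
  rw [not_lt, abs_le] at hcon
  refine hn.2 (hP _ ?_ ?_)
  · have : (M : ℝ) ≤ Ω n + K := by linarith
    exact_mod_cast this
  · have : (Ω n : ℝ) ≤ M + K := by linarith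
    exact_mod_cast this

section Analytic

variable {P : ℕ → Prop} [DecidablePred P]

lemma logAverage_eq (N : ℕ) : logAverage (fun n => if P (Ω n) then 1 else 0) N =
    (1 / Real.log N) * ∑ n ∈ (Finset.Icc 1 N).filter (fun n => P (Ω n)), (1 : ℝ) / n := by
  rw [logAverage, Finset.sum_filter]
  congr 1
  exact Finset.sum_congr rfl fun n _ => by split_ifs <;> simp

lemma logAverage_nonneg (N : ℕ) : 0 ≤ logAverage (fun n => if P (Ω n) then 1 else 0) N := by
  rw [logAverage_eq]
  exact mul_nonneg (one_div_nonneg.2 (Real.log_natCast_nonneg N))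
    (Finset.sum_nonneg fun _ _ => by positivity)

lemma logAverage_le (N : ℕ) : logAverage (fun n => if P (Ω n) then 1 else 0) N ≤
    1 / Real.log N + 1 := by
  rcases (Real.log_natCast_nonneg N).eq_or_lt with h | h
  · rw [logAverage_eq, ← h]; simp
  · have : ∑ n ∈ (Finset.Icc 1 N).filter (fun n => P (Ω n)), (1 : ℝ) / n ≤ 1 + Real.log N :=
      (Finset.sum_le_sum_of_subset_of_nonneg (Finset.filter_subset _ _)
        fun _ _ _ => by positivity).trans (harmonicSum_le_one_add_log N)
    rw [logAverage_eq]
    calc _ ≤ 1 / Real.log N * (1 + Real.log N) := by gcongr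
      _ = _ := by field_simp

lemma tendsto_one_div_log_add_one :
    Tendsto (fun N : ℕ => 1 / Real.log N + 1) atTop (nhds 1) := by
  have h : Tendsto (fun N : ℕ => Real.log N) atTop atTop :=
    Real.tendsto_log_atTop.comp tendsto_natCast_atTop_atTop
  simpa using (h.inv_tendsto_atTop).add_const (1 : ℝ)

lemma isBoundedUnder_le_logAverage : IsBoundedUnder (· ≤ ·) atTop
    (fun N : ℕ => logAverage (fun n => if P (Ω n) then 1 else 0) N) :=
  tendsto_one_div_log_add_one.isBoundedUnder_le.mono_le (Eventually.of_forall logAverage_le)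

lemma isBoundedUnder_ge_logAverage : IsBoundedUnder (· ≥ ·) atTop
    (fun N : ℕ => logAverage (fun n => if P (Ω n) then 1 else 0) N) :=
  isBoundedUnder_of ⟨0, logAverage_nonneg⟩

lemma one_le_log_of_three_le {N : ℕ} (h : 3 ≤ N) : 1 ≤ Real.log N := by
  have h3 : (3 : ℝ) ≤ N := by exact_mod_cast h
  rw [Real.le_log_iff_exp_le (by linarith)]
  linarith [Real.exp_one_lt_d9]

lemma limsup_logAverage_eq_one (h : ∃ᶠ m in atTop, ∃ H, HasRun P m H) :
    limsup (fun N : ℕ => logAverage (fun n => if P (Ω n) then 1 else 0) N) atTop = 1 := by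
  obtain ⟨C, hC0, hC⟩ := exists_sum_not_run_le
  refine le_antisymm ?_ ?_
  · exact (limsup_le_limsup (Eventually.of_forall logAverage_le)
      isBoundedUnder_ge_logAverage.isCoboundedUnder_le
      tendsto_one_div_log_add_one.isBoundedUnder_le).trans_eq
        tendsto_one_div_log_add_one.limsup_eq
  · refine le_of_forall_pos_sub_le fun η hη => ?_
    refine le_limsup_of_frequently_le ?_ isBoundedUnder_le_logAverage
    rw [frequently_atTop] at h ⊢
    intro N₀
    -- `⌈C⌉₊` makes `1 - C / m` nonnegative, so that `harmonicSum N` may be replaced by the smaller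
    -- `log N`.
    obtain ⟨m, hm, H, hrun⟩ := h (max (max N₀ 3) (max ⌈C⌉₊ ⌈C / η⌉₊))
    simp only [max_le_iff] at hm
    obtain ⟨⟨hm1, hm2⟩, hm3, hm4⟩ := hm
    obtain ⟨N, hmN, hN⟩ := hC P m H (by omega) hrun
    refine ⟨N, hm1.trans hmN, ?_⟩
    have hm' : (0 : ℝ) < m := by exact_mod_cast (by omega : 0 < m)
    have hl := one_le_log_of_three_le (hm2.trans hmN)
    have hH := log_le_harmonicSum N
    have hs := Finset.sum_filter_add_sum_filter_not (Finset.Icc 1 N) (fun n => P (Ω n))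
      (fun n => (1 : ℝ) / n)
    change _ = harmonicSum N at hs
    have hc1 : C / m ≤ 1 := (div_le_one hm').2 (Nat.ceil_le.1 hm3)
    have hc2 : C / m ≤ η := by
      rw [div_le_iff₀ hm', ← div_le_iff₀' hη]; exact Nat.ceil_le.1 hm4
    rw [logAverage_eq, one_div_mul_eq_div, le_div_iff₀ (by linarith)]
    have : (1 - C / m) * Real.log N ≤ (1 - C / m) * harmonicSum N :=
      mul_le_mul_of_nonneg_left hH (by linarith)
    nlinarith

lemma liminf_logAverage_eq_zero (h : ∃ᶠ m in atTop, ∃ H, HasRun (fun k => ¬ P k) m H) :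
    liminf (fun N : ℕ => logAverage (fun n => if P (Ω n) then 1 else 0) N) atTop = 0 := by
  obtain ⟨C, hC0, hC⟩ := exists_sum_not_run_le
  refine le_antisymm ?_ ?_
  · refine le_of_forall_pos_le_add fun η hη => ?_
    refine liminf_le_of_frequently_le ?_ isBoundedUnder_ge_logAverage
    rw [frequently_atTop] at h ⊢
    intro N₀
    -- The factor `2` covers `harmonicSum N ≤ 1 + log N ≤ 2 log N`, valid for `N ≥ 3`.
    obtain ⟨m, hm, H, hrun⟩ := h (max (max N₀ 3) ⌈2 * C / η⌉₊)
    simp only [max_le_iff] at hm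
    obtain ⟨⟨hm1, hm2⟩, hm4⟩ := hm
    obtain ⟨N, hmN, hN⟩ := hC (fun k => ¬ P k) m H (by omega) hrun
    simp only [not_not] at hN
    refine ⟨N, hm1.trans hmN, ?_⟩
    have hm' : (0 : ℝ) < m := by exact_mod_cast (by omega : 0 < m)
    have hl := one_le_log_of_three_le (hm2.trans hmN)
    have hH := harmonicSum_le_one_add_log N
    have hc2 : 2 * (C / m) ≤ η := by
      rw [← mul_div_assoc, div_le_iff₀ hm', ← div_le_iff₀' hη]; exact Nat.ceil_le.1 hm4
    have hc0 : 0 < C / m := by positivity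
    rw [logAverage_eq, one_div_mul_eq_div, div_le_iff₀ (by linarith)]
    nlinarith
  · exact le_liminf_of_le isBoundedUnder_le_logAverage.isCoboundedUnder_ge
      (Eventually.of_forall logAverage_nonneg)

end Analytic

/-! ### Sets of small positive measure -/

/-- Closed balls about a point of the support have positive measure and shrink to a null singleton.
-/
lemma exists_measurableSet_measure_pos_le {X : Type*} [MetricSpace X] [CompactSpace X]
    [MeasurableSpace X] [BorelSpace X] (μ : Measure X) [IsProbabilityMeasure μ]
    [NullSingletonClass μ] {η : ENNReal} (hη : 0 < η) :
    ∃ B, MeasurableSet B ∧ 0 < μ B ∧ μ B ≤ η := by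
  obtain ⟨x, hx⟩ := Measure.nonempty_support (IsProbabilityMeasure.ne_zero μ)
  rw [Measure.mem_support_iff_forall] at hx
  have h : Tendsto (fun n : ℕ => μ (Metric.closedBall x (1 / ((n : ℝ) + 1)))) atTop
      (nhds (μ (⋂ n : ℕ, Metric.closedBall x (1 / ((n : ℝ) + 1))))) := by
    refine tendsto_measure_iInter_atTop
      (fun n => Metric.isClosed_closedBall.measurableSet.nullMeasurableSet) ?_
      ⟨0, measure_ne_top _ _⟩
    intro a b hab
    exact Metric.closedBall_subset_closedBall (one_div_le_one_div_of_le (by positivity)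
      (by exact_mod_cast Nat.add_le_add_right hab 1))
  have h0 : (⋂ n : ℕ, Metric.closedBall x (1 / ((n : ℝ) + 1))) = {x} := by
    refine Set.Subset.antisymm (fun y hy => ?_) ?_
    · have : dist y x ≤ 0 := ge_of_tendsto' tendsto_one_div_add_atTop_nhds_zero_nat
        fun n => Metric.mem_closedBall.1 (Set.mem_iInter.1 hy n)
      exact dist_le_zero.1 this
    · rw [Set.singleton_subset_iff, Set.mem_iInter]
      exact fun n => Metric.mem_closedBall_self (by positivity)
  rw [h0, measure_singleton] at h
  obtain ⟨n, hn⟩ := (h.eventually (gt_mem_nhds hη)).exists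
  exact ⟨_, Metric.isClosed_closedBall.measurableSet,
    hx _ (Metric.closedBall_mem_nhds x (by positivity)), hn.le⟩

/-! ### First hitting times and towers -/

section Hitting

variable {X : Type*}

/-- The orbit of `x` under `T` enters `B` for the first time at time `k`. -/
def FirstHit (T : X → X) (B : Set X) (k : ℕ) (x : X) : Prop :=
  T^[k] x ∈ B ∧ ∀ i < k, T^[i] x ∉ B

variable {T : X → X} {B : Set X}

lemma FirstHit.unique {k l : ℕ} {x : X} (hk : FirstHit T B k x) (hl : FirstHit T B l x) :
    k = l := by
  rcases lt_trichotomy k l with h | h | h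
  · exact absurd hk.1 (hl.2 k h)
  · exact h
  · exact absurd hl.1 (hk.2 l h)

lemma FirstHit.iterate {k i : ℕ} {x : X} (h : FirstHit T B (k + i) x) :
    FirstHit T B k (T^[i] x) := by
  refine ⟨?_, fun j hj => ?_⟩
  · rw [← Function.iterate_add_apply]; exact h.1
  · rw [← Function.iterate_add_apply]; exact h.2 _ (by omega)

lemma exists_firstHit {x : X} (h : ∃ k, T^[k] x ∈ B) : ∃ k, FirstHit T B k x := by
  classical
  exact ⟨Nat.find h, Nat.find_spec h, fun i hi => Nat.find_min h hi⟩

/-- The points whose first hitting time of `B` is a positive multiple of `n`. -/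
def towerBase (T : X → X) (B : Set X) (n : ℕ) : Set X :=
  {x | ∃ q : ℕ, FirstHit T B ((q + 1) * n) x}

/-- Moving `d` steps lowers the first hitting time by `d`, leaving residue `n - d ≠ 0` modulo `n`.
-/
lemma not_mem_towerBase_of_iterate {n d : ℕ} {x : X} (hd : 0 < d) (hdn : d < n)
    (hx : x ∈ towerBase T B n) : T^[d] x ∉ towerBase T B n := by
  rintro ⟨q', hq'⟩
  obtain ⟨q, hq⟩ := hx
  have he : (q + 1) * n = (q * n + (n - d)) + d := by
    rw [add_mul]; omega
  rw [he] at hq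
  have h := hq.iterate.unique hq'
  have h1 : (q * n + (n - d)) / n = q := by
    rw [mul_comm, Nat.mul_add_div (by omega), Nat.div_eq_of_lt (by omega), add_zero]
  have h2 : (q * n + (n - d)) % n = n - d := by
    rw [mul_comm, Nat.mul_add_mod, Nat.mod_eq_of_lt (by omega)]
  rw [h, Nat.mul_mod_left] at h2
  omega

variable [MeasurableSpace X]

lemma measurableSet_towerBase (hT : Measurable T) (hB : MeasurableSet B) (n : ℕ) :
    MeasurableSet (towerBase T B n) := by
  have : towerBase T B n = ⋃ q : ℕ, (T^[(q + 1) * n] ⁻¹' B ∩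
      ⋂ i ∈ Set.Iio ((q + 1) * n), (T^[i] ⁻¹' B)ᶜ) := by
    ext x
    simp [towerBase, FirstHit]
  rw [this]
  refine MeasurableSet.iUnion fun q => ((hT.iterate _) hB).inter ?_
  exact MeasurableSet.biInter (Set.to_countable _) fun i _ => ((hT.iterate i) hB).compl

variable {μ : Measure X}

/-- The first `n` preimages of the base are pairwise disjoint and of equal measure. -/
lemma mul_measure_towerBase_le [IsProbabilityMeasure μ] (hT : MeasurePreserving T μ μ) (hB : MeasurableSet B) (n : ℕ) :
    n * μ (towerBase T B n) ≤ 1 := by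
  have hE := measurableSet_towerBase hT.measurable hB n
  have hdisj : Set.PairwiseDisjoint (Finset.range n : Set ℕ)
      (fun i => T^[i] ⁻¹' towerBase T B n) := by
    have key : ∀ i j, i < j → j < n →
        Disjoint (T^[i] ⁻¹' towerBase T B n) (T^[j] ⁻¹' towerBase T B n) := by
      intro i j hij hj
      rw [Set.disjoint_left]
      intro x hx hx'
      refine not_mem_towerBase_of_iterate (d := j - i) (by omega) (by omega) hx ?_
      rw [← Function.iterate_add_apply, Nat.sub_add_cancel hij.le]
      exact hx'
    intro i hi j hj hij
    have hi' := Finset.mem_range.1 hi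
    have hj' := Finset.mem_range.1 hj
    rcases lt_or_gt_of_ne hij with h | h
    · exact key i j h hj'
    · exact (key j i h hi').symm
  calc n * μ (towerBase T B n) = ∑ i ∈ Finset.range n, μ (T^[i] ⁻¹' towerBase T B n) := by
        simp [(hT.iterate _).measure_preimage hE.nullMeasurableSet]
    _ = μ (⋃ i ∈ Finset.range n, T^[i] ⁻¹' towerBase T B n) :=
        (measure_biUnion_finset hdisj fun i _ => (hT.iterate i).measurable hE).symm
    _ ≤ 1 := prob_le_one

lemma measure_exists_iterate_mem_le (hT : MeasurePreserving T μ μ) {S : Set X}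
    (hS : MeasurableSet S) (n : ℕ) : μ {x | ∃ k < n, T^[k] x ∈ S} ≤ n * μ S := by
  have : {x | ∃ k < n, T^[k] x ∈ S} = ⋃ k ∈ Finset.range n, T^[k] ⁻¹' S := by
    ext x; simp
  rw [this]
  refine (measure_biUnion_finset_le _ _).trans (le_of_eq ?_)
  simp [(hT.iterate _).measure_preimage hS.nullMeasurableSet]

lemma ae_exists_iterate_mem [IsProbabilityMeasure μ] (hT : Ergodic T μ) (hB : MeasurableSet B) (hpos : 0 < μ B) :
    ∀ᵐ x ∂μ, ∃ k, T^[k] x ∈ B := by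
  have hm : MeasurableSet (⋃ k, T^[k] ⁻¹' B) :=
    MeasurableSet.iUnion fun k => (hT.measurable.iterate k) hB
  have hsub : T ⁻¹' (⋃ k, T^[k] ⁻¹' B) ⊆ ⋃ k, T^[k] ⁻¹' B := by
    intro x hx
    obtain ⟨k, hk⟩ := Set.mem_iUnion.1 hx
    exact Set.mem_iUnion.2 ⟨k + 1, hk⟩
  rcases hT.ae_empty_or_univ_of_preimage_ae_le hm.nullMeasurableSet hsub.eventuallyLE with h | h
  · have h0 : μ (⋃ k, T^[k] ⁻¹' B) = 0 := by rw [measure_congr h, measure_empty]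
    have h1 : B ⊆ ⋃ k, T^[k] ⁻¹' B := Set.subset_iUnion (fun k => T^[k] ⁻¹' B) 0
    exact absurd (measure_mono_null h1 h0) hpos.ne'
  · filter_upwards [eventuallyEq_univ.1 h] with x hx
    exact Set.mem_iUnion.1 hx

/-- Sets of small measure in which most orbits make a long stay within bounded time. -/
lemma exists_hasRun_set [IsProbabilityMeasure μ] (hT : Ergodic T μ)
    (hsmall : ∀ η : ENNReal, 0 < η → ∃ B, MeasurableSet B ∧ 0 < μ B ∧ μ B ≤ η)
    {δ : ℝ} (hδ : 0 < δ) (m : ℕ) :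
    ∃ (S : Set X) (H : ℕ), MeasurableSet S ∧ μ S ≤ ENNReal.ofReal δ ∧
      μ {x | ¬ HasRun (fun k => T^[k] x ∈ S) m H} ≤ ENNReal.ofReal δ := by
  -- With `K = 2 * a * c` and `n = K * c`, one has `K ^ 2 = a * (2 * n)`, long enough for a run
  -- before time `2 * n`, while `(2 * K + 1) / n ≤ 3 / c ≤ δ`.
  obtain ⟨c, hc⟩ := exists_nat_ge (max 2 (3 / δ))
  have hc2 : 2 ≤ c := by exact_mod_cast (le_max_left _ _).trans hc
  have hcδ : 3 ≤ c * δ := (div_le_iff₀ hδ).1 ((le_max_right _ _).trans hc)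
  set a := m + 1 with ha
  set K := 2 * a * c with hK
  set n := K * c with hn
  have ha1 : 1 ≤ a := by omega
  have hK0 : 2 ≤ K := by rw [hK]; nlinarith
  have haK : a ≤ K := by rw [hK]; nlinarith
  have hKn : 2 * K ≤ n := by rw [hn]; nlinarith
  have hn0 : 0 < n := by omega
  obtain ⟨B, hB, hB0, hBle⟩ := hsmall (ENNReal.ofReal (δ / (2 * n : ℕ)))
    (ENNReal.ofReal_pos.2 (by positivity))
  have hE := measurableSet_towerBase hT.measurable hB n
  set E := towerBase T B n with hEdef
  refine ⟨{x | ∃ i < 2 * K + 1, T^[i] x ∈ E}, 2 * n, ?_, ?_, ?_⟩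
  · have : {x | ∃ k < 2 * K + 1, T^[k] x ∈ E} =
        ⋃ k ∈ Finset.range (2 * K + 1), T^[k] ⁻¹' E := by
      ext x; simp
    rw [this]
    exact Finset.measurableSet_biUnion _ fun k _ => (hT.measurable.iterate k) hE
  · refine (measure_exists_iterate_mem_le hT.toMeasurePreserving hE _).trans ?_
    have h1 := mul_measure_towerBase_le hT.toMeasurePreserving hB n
    rw [← hEdef] at h1
    have h2 : ((2 * K + 1 : ℕ) : ENNReal) ≤ ENNReal.ofReal δ * n := by
      rw [← ENNReal.ofReal_natCast n, ← ENNReal.ofReal_mul hδ.le, ← ENNReal.ofReal_natCast]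
      refine ENNReal.ofReal_le_ofReal ?_
      have : (2 : ℝ) ≤ K := by exact_mod_cast hK0
      rw [hn]; push_cast
      nlinarith
    calc ((2 * K + 1 : ℕ) : ENNReal) * μ E ≤ ENNReal.ofReal δ * n * μ E := by gcongr
      _ = ENNReal.ofReal δ * (n * μ E) := mul_assoc _ _ _
      _ ≤ ENNReal.ofReal δ * 1 := by gcongr
      _ = _ := mul_one _
  · have hsub : {x | ¬ HasRun (fun k => T^[k] x ∈ {x | ∃ i < 2 * K + 1, T^[i] x ∈ E}) m (2 * n)}
        ≤ᵐ[μ] {x | ∃ k < 2 * n, T^[k] x ∈ B} := by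
      filter_upwards [ae_exists_iterate_mem hT hB hB0] with x hx hrun
      by_contra hcon
      refine hrun ?_
      obtain ⟨r, hr⟩ := exists_firstHit hx
      have hr2 : 2 * n ≤ r := by
        by_contra hlt
        exact hcon ⟨r, not_le.1 hlt, hr.1⟩
      -- Writing the hitting time as `(q + 2) * n + s`, the orbit is in `E` at time `s + n`, with
      -- `(q + 1) * n` steps left. Hence it is in the chosen set throughout `[s + n - 2 * K, s +
      -- n]`, the run centred at `s + n - K`.
      obtain ⟨q, hq⟩ : ∃ q, r / n = q + 2 := ⟨r / n - 2, by
        have := (Nat.le_div_iff_mul_le hn0).2 hr2; omega⟩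
      have hmod := Nat.mod_lt r hn0
      have hdiv := Nat.div_add_mod r n
      set s := r % n with hs
      rw [hq] at hdiv
      have hrs : r = (q + 1) * n + (s + n) := by rw [← hdiv]; ring
      rw [hrs] at hr
      have hmem : T^[s + n] x ∈ E := ⟨q, hr.iterate⟩
      refine ⟨s + n - K, K, by omega, by omega, ?_, by omega, fun k hk1 hk2 => ?_⟩
      · calc m * (s + n - K) ≤ a * (2 * n) := Nat.mul_le_mul (by omega) (by omega)
          _ = K ^ 2 := by rw [hn, hK]; ring
      · refine ⟨s + n - k, by omega, ?_⟩
        rw [← Function.iterate_add_apply, Nat.sub_add_cancel (by omega)]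
        exact hmem
    refine (measure_mono_ae hsub).trans ?_
    refine (measure_exists_iterate_mem_le hT.toMeasurePreserving hB _).trans ?_
    calc ((2 * n : ℕ) : ENNReal) * μ B
        ≤ ENNReal.ofReal (2 * n : ℕ) * ENNReal.ofReal (δ / (2 * n : ℕ)) := by
          rw [ENNReal.ofReal_natCast]; gcongr
      _ = ENNReal.ofReal δ := by
          rw [← ENNReal.ofReal_mul (by positivity)]
          congr 1
          have : ((2 * n : ℕ) : ℝ) ≠ 0 := by positivity
          field_simp

end Hitting

/-! ### Gluing the runs by Borel–Cantelli -/

lemma tsum_ofReal_le_of_halving {δ : ℕ → ℝ} (h0 : ∀ j, 0 ≤ δ j)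
    (h : ∀ j, δ (j + 1) ≤ δ j / 2) : ∑' j, ENNReal.ofReal (δ j) ≤ ENNReal.ofReal (2 * δ 0) := by
  have hle : ∀ j, δ j ≤ δ 0 * (1 / 2) ^ j := by
    intro j
    induction j with
    | zero => simp
    | succ j ih => rw [pow_succ]; linarith [h j]
  have hs : HasSum (fun j : ℕ => δ 0 * (1 / 2 : ℝ) ^ j) (δ 0 * 2) := hasSum_geometric_two.mul_left _
  have hnn : ∀ j : ℕ, 0 ≤ δ 0 * (1 / 2 : ℝ) ^ j := fun j => mul_nonneg (h0 0) (by positivity)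
  calc ∑' j, ENNReal.ofReal (δ j) ≤ ∑' j : ℕ, ENNReal.ofReal (δ 0 * (1 / 2) ^ j) :=
        ENNReal.tsum_le_tsum fun j => ENNReal.ofReal_le_ofReal (hle j)
    _ = ENNReal.ofReal (2 * δ 0) := by
        rw [← ENNReal.ofReal_tsum_of_nonneg hnn hs.summable, hs.tsum_eq, mul_comm]

/-- A small set that orbits both occupy and avoid for long stretches of time. -/
lemma exists_set_frequently_hasRun {X : Type*} [MeasurableSpace X] {μ : Measure X}
    [IsProbabilityMeasure μ] {T : X → X} (hT : Ergodic T μ)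
    (hsmall : ∀ η : ENNReal, 0 < η → ∃ B, MeasurableSet B ∧ 0 < μ B ∧ μ B ≤ η)
    {ε : ℝ} (hε : 0 < ε) :
    ∃ A : Set X, MeasurableSet A ∧ μ A < ENNReal.ofReal ε ∧ ∀ᵐ x ∂μ,
      (∃ᶠ m in atTop, ∃ H, HasRun (fun k => T^[k] x ∈ A) m H) ∧
      (∃ᶠ m in atTop, ∃ H, HasRun (fun k => ¬ T^[k] x ∈ A) m H) := by
  have hex : ∀ (d : {d : ℝ // 0 < d}) (m : ℕ), ∃ (S : Set X) (H : ℕ), MeasurableSet S ∧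
      μ S ≤ ENNReal.ofReal d ∧
      μ {x | ¬ HasRun (fun k => T^[k] x ∈ S) m H} ≤ ENNReal.ofReal d :=
    fun d m => exists_hasRun_set hT hsmall d.2 m
  choose S' H' hS'm hS'μ hS'r using hex
  -- The next tolerance depends on the time bound just obtained: all later sets have total measure
  -- at most `2 * δ (j + 1)`, so the points meeting them within `H j + 1` steps have measure at most
  -- `δ j`.
  let d : ℕ → {d : ℝ // 0 < d} := fun j => Nat.rec ⟨ε / 4, by positivity⟩
    (fun j e => ⟨e / (2 * (H' e j + 1)), div_pos e.2 (by positivity)⟩) j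
  let δ : ℕ → ℝ := fun j => (d j : {d : ℝ // 0 < d}).1
  let S : ℕ → Set X := fun j => S' (d j) j
  let H : ℕ → ℕ := fun j => H' (d j) j
  have hδ0 : δ 0 = ε / 4 := rfl
  have hδpos : ∀ j, 0 < δ j := fun j => (d j).2
  have hδs : ∀ j, δ (j + 1) = δ j / (2 * (H j + 1)) := fun j => rfl
  have hSm : ∀ j, MeasurableSet (S j) := fun j => hS'm _ _
  have hSμ : ∀ j, μ (S j) ≤ ENNReal.ofReal (δ j) := fun j => hS'μ _ _
  have hSr : ∀ j, μ {x | ¬ HasRun (fun k => T^[k] x ∈ S j) j (H j)} ≤ ENNReal.ofReal (δ j) :=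
    fun j => hS'r _ _
  have hhalf : ∀ j, δ (j + 1) ≤ δ j / 2 := fun j => by
    rw [hδs]
    refine div_le_div_of_nonneg_left (hδpos j).le (by norm_num) ?_
    linarith [Nat.cast_nonneg (α := ℝ) (H j)]
  have htail : ∀ j, μ (⋃ i, S (j + i)) ≤ ENNReal.ofReal (2 * δ j) := fun j =>
    ((measure_iUnion_le _).trans (ENNReal.tsum_le_tsum fun i => hSμ (j + i))).trans
      (tsum_ofReal_le_of_halving (δ := fun i => δ (j + i)) (fun i => (hδpos _).le)
        fun i => hhalf (j + i))
  have htm : ∀ j, MeasurableSet (⋃ i, S (j + i)) := fun j => MeasurableSet.iUnion fun i => hSm _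
  have hesc : ∀ j, μ {x | ∃ k < H j + 1, T^[k] x ∈ ⋃ i, S (j + 1 + i)} ≤
      ENNReal.ofReal (δ j) := by
    intro j
    refine (measure_exists_iterate_mem_le hT.toMeasurePreserving (htm _) _).trans ?_
    calc ((H j + 1 : ℕ) : ENNReal) * μ (⋃ i, S (j + 1 + i))
        ≤ ENNReal.ofReal (H j + 1 : ℕ) * ENNReal.ofReal (2 * δ (j + 1)) := by
          rw [ENNReal.ofReal_natCast]; gcongr; exact htail _
      _ = ENNReal.ofReal (δ j) := by
          rw [← ENNReal.ofReal_mul (by positivity), hδs]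
          congr 1
          push_cast
          field_simp
  have hsum : ∑' j, ENNReal.ofReal (δ j) ≠ ⊤ :=
    ne_top_of_le_ne_top ENNReal.ofReal_ne_top
      (tsum_ofReal_le_of_halving (fun j => (hδpos j).le) hhalf)
  have hbc1 := ae_eventually_notMem
    (ne_top_of_le_ne_top hsum (ENNReal.tsum_le_tsum fun j => hSr j))
  have hbc2 := ae_eventually_notMem
    (ne_top_of_le_ne_top hsum (ENNReal.tsum_le_tsum fun j => hesc j))
  -- A point of `S j` outside all later sets is in `A` exactly when `j` is even, whatever the
  -- earlier sets.
  let A : Set X := ⋃ j, S (2 * j) \ ⋃ i, S (2 * j + 1 + i)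
  have hA_even : ∀ j y, y ∈ S (2 * j) → y ∉ ⋃ i, S (2 * j + 1 + i) → y ∈ A :=
    fun j y h1 h2 => Set.mem_iUnion.2 ⟨j, h1, h2⟩
  have hA_odd : ∀ j y, y ∈ S (2 * j + 1) → y ∉ ⋃ i, S (2 * j + 1 + 1 + i) → y ∉ A := by
    intro j y h1 h2 hy
    obtain ⟨i, hi1, hi2⟩ := Set.mem_iUnion.1 hy
    -- For `i ≤ j` the set `S (2 * j + 1)` is among those removed from `S (2 * i)`; for `i > j` the
    -- point avoids `S (2 * i)` by `h2`.
    rcases le_or_gt i j with h | h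
    · refine hi2 (Set.mem_iUnion.2 ⟨2 * j - 2 * i, ?_⟩)
      rwa [show 2 * i + 1 + (2 * j - 2 * i) = 2 * j + 1 by omega]
    · refine h2 (Set.mem_iUnion.2 ⟨2 * i - (2 * j + 2), ?_⟩)
      rwa [show 2 * j + 1 + 1 + (2 * i - (2 * j + 2)) = 2 * i by omega]
  refine ⟨A, MeasurableSet.iUnion fun j => (hSm _).diff (htm _), ?_, ?_⟩
  · have hsub : A ⊆ ⋃ i, S (0 + i) := by
      refine Set.iUnion_subset fun j => Set.sdiff_subset.trans ?_
      exact (Set.subset_iUnion (fun i => S (0 + i)) (2 * j)).trans' (by rw [zero_add])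
    refine (measure_mono hsub).trans_lt ((htail 0).trans_lt ?_)
    rw [hδ0]
    exact (ENNReal.ofReal_lt_ofReal_iff hε).2 (by linarith)
  · filter_upwards [hbc1, hbc2] with x hx1 hx2
    obtain ⟨J, hJ⟩ := eventually_atTop.1 (hx1.and hx2)
    have hrun : ∀ j, J ≤ j → HasRun (fun k => T^[k] x ∈ S j) j (H j) ∧
        ∀ k ≤ H j, T^[k] x ∉ ⋃ i, S (j + 1 + i) := fun j hj =>
      ⟨not_not.1 (hJ j hj).1, fun k hk hmem => (hJ j hj).2 ⟨k, Nat.lt_succ_of_le hk, hmem⟩⟩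
    constructor
    · refine frequently_atTop.2 fun m₀ => ⟨2 * (m₀ + J), by omega, H (2 * (m₀ + J)), ?_⟩
      obtain ⟨h1, h2⟩ := hrun (2 * (m₀ + J)) (by omega)
      exact h1.imp fun k hk hmem => hA_even _ _ hmem (h2 k hk)
    · refine frequently_atTop.2 fun m₀ => ⟨2 * (m₀ + J) + 1, by omega, H (2 * (m₀ + J) + 1), ?_⟩
      obtain ⟨h1, h2⟩ := hrun (2 * (m₀ + J) + 1) (by omega)
      exact h1.imp fun k hk hmem => hA_odd _ _ hmem (h2 k hk)

theorem mainTheorem2 {X : Type*} [MetricSpace X] [CompactSpace X]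
    [MeasurableSpace X] [BorelSpace X]
    (μ : Measure X) [IsProbabilityMeasure μ] [NullSingletonClass μ]
    (T : X → X) (hT : Ergodic T μ) (ε : ℝ) (hε : 0 < ε) :
    ∃ A : Set X, MeasurableSet A ∧ μ A < ENNReal.ofReal ε ∧
      ∀ᵐ x ∂μ,
        limsup (fun N : ℕ => logAverage
          (fun n => A.indicator (fun _ => (1 : ℝ)) (T^[Ω n] x)) N) atTop = 1 ∧
        liminf (fun N : ℕ => logAverage
          (fun n => A.indicator (fun _ => (1 : ℝ)) (T^[Ω n] x)) N) atTop = 0 := by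
  classical
  obtain ⟨A, hA, hAμ, h⟩ := exists_set_frequently_hasRun hT
    (fun η hη => exists_measurableSet_measure_pos_le μ hη) hε
  refine ⟨A, hA, hAμ, ?_⟩
  filter_upwards [h] with x hx
  simp only [Set.indicator_apply]
  exact ⟨limsup_logAverage_eq_one (P := fun k => T^[k] x ∈ A) hx.1,
    liminf_logAverage_eq_zero (P := fun k => T^[k] x ∈ A) hx.2⟩
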